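/- Let $K$ be an algebraically closed field of characteristic zero (for example $K=\mathbb{C}$), let $n\ge 3$, let $A^{(i)}=K^{m_i}$ for $1\le i\le n$, and let $T\in A^{(1)}\otimes\cdots\otimes A^{(n)}$, regarded also as a multilinear function $T:A^{(1)*}\times\cdots\times A^{(n)*}\to K$. The geometric rank $\mathrm{GR}(T)$ is the codimension in $A^{(1)*}\times\cdots\times A^{(n-1)*}$ of the Zariski closed set $$\{(x_1,\dots,x_{n-1})\in A^{(1)*}\times\cdots\times A^{(n-1)*}\mid T(x_1,\dots,x_{n-1},x_n)=0\ \text{ for all } x_n\in A^{(n)*}\}.$$ The tensor $T$ has partition rank $1$ if there are a partition $\{1,\dots,n\}=I\sqcup J$ into two nonempty sets and nonzero tensors $T_1\in\bigotimes_{i\in I}A^{(i)}$ and $T_2\in\bigotimes_{j\in J}A^{(j)}$ with $T=T_1\otimes T_2$. Then $\mathrm{GR}(T)=1$ if and only if $T$ has partition rank $1$. -/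

import Mathlib

open scoped TensorProduct

/-- The space `K^{m₁} ⊗ ⋯ ⊗ K^{mₙ}` of `n`-part tensors of format `m` over `K`. -/
abbrev PartTensor (K : Type*) [Field K] {n : ℕ} (m : Fin n → ℕ) : Type _ :=
  ⨂[K] i, (Fin (m i) → K)

namespace PartTensor

variable {K : Type*} [Field K]

/-- The tensor `T`, regarded as a multilinear function on the product of the dual spaces. On
`T = a₁ ⊗ ⋯ ⊗ aₙ` it is `(x₁, …, xₙ) ↦ x₁(a₁) ⋯ xₙ(aₙ)`. -/
noncomputable def toMultilinear {n : ℕ} {m : Fin n → ℕ} (T : PartTensor K m) :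
    MultilinearMap K (fun i => Module.Dual K (Fin (m i) → K)) K :=
  (LinearMap.applyₗ T ∘ₗ PiTensorProduct.dualDistrib).compMultilinearMap (PiTensorProduct.tprod K)

theorem toMultilinear_tprod {n : ℕ} {m : Fin n → ℕ} (a : ∀ i, Fin (m i) → K)
    (x : ∀ i, Module.Dual K (Fin (m i) → K)) :
    toMultilinear (PiTensorProduct.tprod K a : PartTensor K m) x = ∏ i, x i (a i) := by
  simp [toMultilinear]

/-- For an `(n+1)`-part tensor `T`, the set of all `(x₁, …, xₙ)` in the product of the first `n`
dual spaces such that `T(x₁, …, xₙ, y) = 0` for all `y` in the last dual space. -/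
def kernelLocus {n : ℕ} {m : Fin (n + 1) → ℕ} (T : PartTensor K m) :
    Set (∀ i : Fin n, Module.Dual K (Fin (m i.castSucc) → K)) :=
  {x | ∀ y : Module.Dual K (Fin (m (Fin.last n)) → K),
    T.toMultilinear (Fin.snoc (α := fun i => Module.Dual K (Fin (m i) → K)) x y) = 0}

/-- The point of `(K^{d₁})* × ⋯ × (K^{dₙ})*` with the given coordinates with respect to the bases
dual to the standard ones. This identifies the product with the affine space whose coordinates
are indexed by the pairs `(i, j)` with `j < dᵢ`. -/
def ofCoords {n : ℕ} {d : Fin n → ℕ} (c : (Σ i : Fin n, Fin (d i)) → K) :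
    ∀ i, Module.Dual K (Fin (d i) → K) :=
  fun i => dotProductEquiv K (Fin (d i)) (fun j => c ⟨i, j⟩)

/-- The codimension of a Zariski closed subset `Z` of the affine space `K^σ` (for `K` algebraically
closed): the height of the ideal of all polynomials vanishing on `Z`, that is, the least
codimension of an irreducible component of `Z`. -/
noncomputable def codim {σ : Type*} (Z : Set (σ → K)) : ℕ∞ :=
  (MvPolynomial.vanishingIdeal K Z).height

/-- The geometric rank of an `(n+1)`-part tensor: the codimension of its kernel locus in the
product of the first `n` dual spaces. -/
noncomputable def geometricRank {n : ℕ} {m : Fin (n + 1) → ℕ} (T : PartTensor K m) : ℕ∞ :=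
  codim (ofCoords ⁻¹' T.kernelLocus)

/-- For a partition `I ⊔ J` of the index set (`J` the complement of `I`), the tensor product
`T₁ ⊗ T₂` of `T₁ ∈ ⨂_{i ∈ I} K^{mᵢ}` and `T₂ ∈ ⨂_{j ∈ J} K^{mⱼ}`, as an `n`-part tensor. -/
noncomputable def outer {n : ℕ} {m : Fin n → ℕ} (I : Finset (Fin n))
    (T₁ : ⨂[K] i : {i // i ∈ I}, (Fin (m i) → K)) (T₂ : ⨂[K] j : {j // j ∉ I}, (Fin (m j) → K)) :
    PartTensor K m :=
  (PiTensorProduct.reindex K (fun i => Fin (m i) → K) (Equiv.sumCompl (· ∈ I)).symm).symm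
    (PiTensorProduct.tmulEquivDep K
      (fun s => Fin (m ((Equiv.sumCompl (· ∈ I)).symm.symm s)) → K) (T₁ ⊗ₜ[K] T₂))

theorem outer_tprod {n : ℕ} {m : Fin n → ℕ} (I : Finset (Fin n)) (a : ∀ i, Fin (m i) → K) :
    outer I (PiTensorProduct.tprod K fun i : {i // i ∈ I} => a i)
      (PiTensorProduct.tprod K fun j : {j // j ∉ I} => a j) = PiTensorProduct.tprod K a := by
  unfold outer
  rw [LinearEquiv.symm_apply_eq, PiTensorProduct.reindex_tprod]
  erw [PiTensorProduct.tmulEquivDep_apply]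
  congr 1
  ext (s | s) <;> rfl

/-- `T` has partition rank one: `T = T₁ ⊗ T₂` with nonzero `T₁`, `T₂` for some partition of the
index set into two nonempty parts. -/
def HasPartitionRankOne {n : ℕ} {m : Fin n → ℕ} (T : PartTensor K m) : Prop :=
  ∃ I : Finset (Fin n), I.Nonempty ∧ Iᶜ.Nonempty ∧
    ∃ (T₁ : ⨂[K] i : {i // i ∈ I}, (Fin (m i) → K))
      (T₂ : ⨂[K] j : {j // j ∉ I}, (Fin (m j) → K)),
      T₁ ≠ 0 ∧ T₂ ≠ 0 ∧ T = outer I T₁ T₂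

end PartTensor

/-!
Write the tensor as a multilinear function and contract it with the standard basis of the last
dual space. The resulting slices `P_k = T(x₁, …, xₙ, e_k*)` are polynomials of degree one in each
of the `n` blocks of variables, and the kernel locus is their common zero set.

If the codimension is one, some prime of height one contains all `P_k`. Polynomial rings are
factorial, so this prime is generated by one polynomial `f`, which divides every `P_k`. Factors of
a multihomogeneous polynomial are multihomogeneous (`IsWeightedHomogeneous.exists_of_mul`), so `f`
has degree one in the blocks of a nonempty set `I` and degree zero in the others
(`exists_blocks_of_dvd`). Comparing coefficients in `P_k = f * g_k` (`coeff_mul_of_blocks`), the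
coefficients of `T` are products of a function of the indices in `I` and a function of the other
ones, the last index being among the latter; that is the required factorization of `T`.

Conversely, if `T = T₁ ⊗ T₂`, one of the factors does not involve the last index. It defines a
hypersurface inside the kernel locus, and the Nullstellensatz and Krull's principal ideal theorem
bound the codimension by one (`geometricRank_le_one`); it is not zero because `T ≠ 0`.
-/

/-! ### Factors of weighted homogeneous polynomials -/

namespace MvPolynomial

section WeightSubst

variable {σ R : Type*} [CommRing R]

/-- The substitution `X s ↦ X s * t ^ w s`. Its effect is to record the weighted degree in the
exponent of the new variable `t`. -/
noncomputable def weightSubst (R : Type*) [CommRing R] (w : σ → ℕ) :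
    MvPolynomial σ R →ₐ[R] Polynomial (MvPolynomial σ R) :=
  aeval fun s => Polynomial.C (X s) * Polynomial.X ^ w s

theorem weightSubst_monomial (w : σ → ℕ) (s : σ →₀ ℕ) (r : R) :
    weightSubst R w (monomial s r) =
      Polynomial.monomial (Finsupp.weight w s) (monomial s r) := by
  have key : (s.prod fun i k => (Polynomial.C (X i : MvPolynomial σ R) * Polynomial.X ^ w i) ^ k) =
      Polynomial.C (s.prod fun i k => X i ^ k) * Polynomial.X ^ Finsupp.weight w s := by
    simp only [Finsupp.prod, mul_pow, Finset.prod_mul_distrib, ← pow_mul,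
      Finset.prod_pow_eq_pow_sum, map_prod, map_pow, Finsupp.weight_apply, Finsupp.sum,
      smul_eq_mul, mul_comm]
  rw [weightSubst, aeval_monomial, key, monomial_eq, ← Polynomial.C_mul_X_pow_eq_monomial, map_mul,
    mul_assoc]
  rfl

/-- The coefficient of `t ^ k` in `weightSubst R w F` is the component of `F` of weighted
degree `k`. -/
theorem coeff_coeff_weightSubst (w : σ → ℕ) (F : MvPolynomial σ R) (s : σ →₀ ℕ) (k : ℕ) :
    coeff s ((weightSubst R w F).coeff k) = if Finsupp.weight w s = k then coeff s F else 0 := by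
  classical
  induction F using MvPolynomial.induction_on' with
  | monomial u r =>
    rw [weightSubst_monomial, Polynomial.coeff_monomial]
    by_cases hu : u = s
    · subst hu
      split_ifs <;> simp
    · split_ifs <;> simp [coeff_monomial, hu]
  | add p q hp hq =>
    rw [map_add, Polynomial.coeff_add, coeff_add, hp, hq]
    split_ifs <;> simp

/-- Factors of a nonzero weighted homogeneous polynomial over a domain are weighted homogeneous.
After the substitution `X s ↦ X s * t ^ w s` the degree and the trailing degree in `t` agree for
the product, and as both are additive, they agree for the factors. -/
theorem IsWeightedHomogeneous.exists_of_mul [IsDomain R] {w : σ → ℕ}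
    {f g : MvPolynomial σ R} {d : ℕ} (h : IsWeightedHomogeneous w (f * g) d)
    (h0 : f * g ≠ 0) :
    ∃ a b, a + b = d ∧ IsWeightedHomogeneous w f a ∧ IsWeightedHomogeneous w g b := by
  classical
  let φ := weightSubst R w
  have hφc := coeff_coeff_weightSubst (R := R) w
  have hφ0 {F : MvPolynomial σ R} (hF : F ≠ 0) : φ F ≠ 0 := by
    obtain ⟨s, hs⟩ := ne_zero_iff.1 hF
    intro h
    have := hφc F s (Finsupp.weight w s)
    rw [h] at this
    simp at this
    exact hs this.symm
  -- A polynomial whose image has equal degree and trailing degree is homogeneous.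
  have hhom {F : MvPolynomial σ R} (hF : (φ F).natDegree ≤ (φ F).natTrailingDegree) :
      IsWeightedHomogeneous w F (φ F).natDegree := by
    intro s hs
    have hne : (φ F).coeff (Finsupp.weight w s) ≠ 0 := fun h => by
      have := hφc F s (Finsupp.weight w s)
      rw [h] at this
      simp at this
      exact hs this.symm
    exact le_antisymm (Polynomial.le_natDegree_of_ne_zero hne)
      (hF.trans (Polynomial.natTrailingDegree_le_of_ne_zero hne))
  have hmon : φ (f * g) = Polynomial.monomial d (f * g) := by
    ext k s
    rw [hφc, Polynomial.coeff_monomial]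
    by_cases hs : coeff s (f * g) = 0
    · split_ifs <;> simp [hs]
    · rw [h hs]
      split_ifs <;> simp
  have hf := left_ne_zero_of_mul h0
  have hg := right_ne_zero_of_mul h0
  have h1 : (φ f).natDegree + (φ g).natDegree = d := by
    rw [← Polynomial.natDegree_mul (hφ0 hf) (hφ0 hg), ← map_mul, hmon,
      Polynomial.natDegree_monomial_eq _ h0]
  have h2 : (φ f).natTrailingDegree + (φ g).natTrailingDegree = d := by
    rw [← Polynomial.natTrailingDegree_mul (hφ0 hf) (hφ0 hg), ← map_mul, hmon,
      Polynomial.natTrailingDegree_monomial h0]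
  have h3 := Polynomial.natTrailingDegree_le_natDegree (φ f)
  have h4 := Polynomial.natTrailingDegree_le_natDegree (φ g)
  exact ⟨_, _, h1, hhom (by omega), hhom (by omega)⟩

end WeightSubst

end MvPolynomial

namespace PartTensor

open MvPolynomial

/-! ### Coefficients of tensors -/

section Coordinates

variable {K : Type*} [Field K]

/-- The basis of a tensor product of coordinate spaces formed by the tensors
`e_{h 1} ⊗ ⋯ ⊗ e_{h n}`. -/
noncomputable def stdBasis (K : Type*) [Field K] {ι : Type*} [Finite ι] (d : ι → ℕ) :
    Module.Basis (∀ i, Fin (d i)) K (⨂[K] i, (Fin (d i) → K)) :=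
  Basis.piTensorProduct fun i => Pi.basisFun K (Fin (d i))

theorem dualDistrib_eq_sum {ι : Type*} [Fintype ι] [DecidableEq ι] {d : ι → ℕ}
    (t : ⨂[K] i, (Fin (d i) → K)) (x : ∀ i, Module.Dual K (Fin (d i) → K)) :
    PiTensorProduct.dualDistrib (PiTensorProduct.tprod K x) t =
      ∑ h, (stdBasis K d).repr t h * ∏ i, x i (Pi.single (h i) 1) := by
  conv_lhs => rw [← (stdBasis K d).sum_repr t]
  simp [stdBasis]

theorem repr_eq_dualDistrib {ι : Type*} [Fintype ι] {d : ι → ℕ}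
    (t : ⨂[K] i, (Fin (d i) → K)) (h : ∀ i, Fin (d i)) :
    (stdBasis K d).repr t h =
      PiTensorProduct.dualDistrib
        (PiTensorProduct.tprod K fun i => (LinearMap.proj (h i) : (Fin (d i) → K) →ₗ[K] K)) t := by
  induction t using PiTensorProduct.induction_on with
  | smul_tprod r a => simp [stdBasis]
  | add s t hs ht => simp only [map_add, Finsupp.add_apply, hs, ht]

/-- The tensor product `outer I` as a bilinear map. -/
noncomputable def outerBilinear {n : ℕ} {m : Fin n → ℕ} (I : Finset (Fin n)) :
    (⨂[K] i : {i // i ∈ I}, (Fin (m i) → K)) →ₗ[K] (⨂[K] j : {j // j ∉ I}, (Fin (m j) → K)) →ₗ[K]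
      PartTensor K m :=
  (TensorProduct.mk K _ _).compr₂
    ((PiTensorProduct.reindex K (fun i => Fin (m i) → K)
        (Equiv.sumCompl (· ∈ I)).symm).symm.toLinearMap ∘ₗ
      (PiTensorProduct.tmulEquivDep K
        (fun s => Fin (m ((Equiv.sumCompl (· ∈ I)).symm.symm s)) → K)).toLinearMap)

theorem outerBilinear_apply {n : ℕ} {m : Fin n → ℕ} (I : Finset (Fin n))
    (T₁ : ⨂[K] i : {i // i ∈ I}, (Fin (m i) → K)) (T₂ : ⨂[K] j : {j // j ∉ I}, (Fin (m j) → K)) :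
    outerBilinear I T₁ T₂ = outer I T₁ T₂ :=
  rfl

theorem toMultilinear_outer {n : ℕ} {m : Fin n → ℕ} (I : Finset (Fin n))
    (T₁ : ⨂[K] i : {i // i ∈ I}, (Fin (m i) → K)) (T₂ : ⨂[K] j : {j // j ∉ I}, (Fin (m j) → K))
    (x : ∀ i, Module.Dual K (Fin (m i) → K)) :
    (outer I T₁ T₂).toMultilinear x =
      PiTensorProduct.dualDistrib (PiTensorProduct.tprod K fun i : {i // i ∈ I} => x i) T₁ *
        PiTensorProduct.dualDistrib (PiTensorProduct.tprod K fun i : {i // i ∉ I} => x i) T₂ := by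
  classical
  simp only [toMultilinear, LinearMap.compMultilinearMap_apply, LinearMap.comp_apply,
    LinearMap.applyₗ_apply_apply]
  rw [← outerBilinear_apply]
  induction T₁ using PiTensorProduct.induction_on with
  | add s t hs ht => simp only [map_add, LinearMap.add_apply, hs, ht, add_mul]
  | smul_tprod r a =>
    induction T₂ using PiTensorProduct.induction_on with
    | add s t hs ht => simp only [map_add, hs, ht, mul_add]
    | smul_tprod r' b =>
      let c : ∀ i, Fin (m i) → K := fun i => if h : i ∈ I then a ⟨i, h⟩ else b ⟨i, h⟩
      have ha : a = fun i : {i // i ∈ I} => c i := by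
        funext i
        simp [c]
      have hb : b = fun i : {i // i ∉ I} => c i := by
        funext i
        simp [c, i.2]
      rw [ha, hb]
      simp only [map_smul, LinearMap.smul_apply, outerBilinear_apply, outer_tprod,
        PiTensorProduct.dualDistrib_apply, smul_eq_mul]
      have key : ∏ i, x i (c i) =
          (∏ i : {i // i ∈ I}, x i (c i)) * ∏ i : {i // i ∉ I}, x i (c i) := by
        rw [← Fintype.prod_subtype_mul_prod_subtype (· ∈ I)]
        congr!
      rw [key]
      ring

theorem repr_outer {n : ℕ} {m : Fin n → ℕ} (I : Finset (Fin n))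
    (T₁ : ⨂[K] i : {i // i ∈ I}, (Fin (m i) → K)) (T₂ : ⨂[K] j : {j // j ∉ I}, (Fin (m j) → K))
    (h : ∀ i, Fin (m i)) :
    (stdBasis K m).repr (outer I T₁ T₂) h =
      (stdBasis K fun i : {i // i ∈ I} => m i).repr T₁ (fun i => h i) *
        (stdBasis K fun i : {i // i ∉ I} => m i).repr T₂ (fun i => h i) := by
  rw [repr_eq_dualDistrib, repr_eq_dualDistrib, repr_eq_dualDistrib]
  exact toMultilinear_outer I T₁ T₂ _

theorem exists_repr_ne_zero {ι : Type*} [Finite ι] {d : ι → ℕ} {t : ⨂[K] i, (Fin (d i) → K)}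
    (ht : t ≠ 0) : ∃ h, (stdBasis K d).repr t h ≠ 0 := by
  by_contra! H
  exact ht ((stdBasis K d).ext_elem fun h => by simp [H h])

theorem outer_ne_zero {n : ℕ} {m : Fin n → ℕ} (I : Finset (Fin n))
    {T₁ : ⨂[K] i : {i // i ∈ I}, (Fin (m i) → K)} {T₂ : ⨂[K] j : {j // j ∉ I}, (Fin (m j) → K)}
    (h₁ : T₁ ≠ 0) (h₂ : T₂ ≠ 0) : outer I T₁ T₂ ≠ 0 := by
  obtain ⟨u, hu⟩ := exists_repr_ne_zero h₁
  obtain ⟨v, hv⟩ := exists_repr_ne_zero h₂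
  intro H
  have := repr_outer I T₁ T₂ fun i => if h : i ∈ I then u ⟨i, h⟩ else v ⟨i, h⟩
  have hu' : (fun i : {i // i ∈ I} =>
      if h : (i : Fin n) ∈ I then u ⟨i, h⟩ else v ⟨i, h⟩) = u := by
    funext i
    simp
  have hv' : (fun i : {i // i ∉ I} =>
      if h : (i : Fin n) ∈ I then u ⟨i, h⟩ else v ⟨i, h⟩) = v := by
    funext i
    simp [i.2]
  rw [H, hu', hv', map_zero] at this
  exact mul_ne_zero hu hv this.symm

end Coordinates

/-! ### Polynomials of degree one in each block of variables -/

section Blocks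

variable {K : Type*} [Field K] {ι : Type*} {d : ι → ℕ}

/-- The exponent of the monomial `∏ i ∈ S, X ⟨i, h i⟩`. -/
noncomputable def blockExponent (S : Finset ι) (h : ∀ i, Fin (d i)) : (Σ i, Fin (d i)) →₀ ℕ :=
  ∑ i ∈ S, Finsupp.single ⟨i, h i⟩ 1

theorem blockExponent_apply [DecidableEq ι] (S : Finset ι) (h : ∀ i, Fin (d i)) (i : ι)
    (j : Fin (d i)) : blockExponent S h ⟨i, j⟩ = if i ∈ S ∧ h i = j then 1 else 0 := by
  rw [blockExponent, Finsupp.finsetSum_apply]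
  have (i' : ι) : (Finsupp.single (⟨i', h i'⟩ : Σ i, Fin (d i)) 1 : _ →₀ ℕ) ⟨i, j⟩ =
      if i = i' then (if h i = j then 1 else 0) else 0 := by
    rw [Finsupp.single_apply]
    by_cases hi : i = i'
    · subst hi
      simp
    · simp [hi, Ne.symm hi]
  simp only [this, Finset.sum_ite_eq]
  by_cases hi : i ∈ S <;> simp [hi]

theorem blockExponent_congr {S : Finset ι} {h h' : ∀ i, Fin (d i)} (H : ∀ i ∈ S, h i = h' i) :
    blockExponent S h = blockExponent S h' :=
  Finset.sum_congr rfl fun i hi => by rw [H i hi]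

variable [Fintype ι] [DecidableEq ι]

theorem blockExponent_univ_injective :
    Function.Injective (blockExponent (d := d) (Finset.univ : Finset ι)) := by
  intro h h' H
  funext i
  have := blockExponent_apply Finset.univ h i (h' i)
  rw [H, blockExponent_apply] at this
  by_contra hne
  simp [hne] at this

/-- The weight whose associated degree is the degree in the `i`-th block of variables. -/
def blockWeight (d : ι → ℕ) (i : ι) : (Σ i, Fin (d i)) → ℕ := fun s => if s.1 = i then 1 else 0

theorem weight_blockWeight (i : ι) (s : (Σ i, Fin (d i)) →₀ ℕ) :
    Finsupp.weight (blockWeight d i) s = ∑ j, s ⟨i, j⟩ := by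
  rw [Finsupp.weight_apply, Finsupp.sum_fintype _ _ (by simp), Fintype.sum_sigma,
    Finset.sum_eq_single i]
  · simp [blockWeight]
  · intro i' _ hi'
    simp [blockWeight, hi']
  · simp

/-- The polynomial `∑ h, c h * ∏ i, X ⟨i, h i⟩`, of degree one in each block of variables. -/
noncomputable def multilinearPoly (c : (∀ i, Fin (d i)) → K) : MvPolynomial (Σ i, Fin (d i)) K :=
  ∑ h, monomial (blockExponent Finset.univ h) (c h)

theorem aeval_multilinearPoly (c : (∀ i, Fin (d i)) → K) (x : (Σ i, Fin (d i)) → K) :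
    aeval x (multilinearPoly c) = ∑ h, c h * ∏ i, x ⟨i, h i⟩ := by
  rw [multilinearPoly, map_sum]
  refine Finset.sum_congr rfl fun h _ => ?_
  rw [blockExponent, aeval_monomial, Finsupp.prod_fintype _ _ (by simp)]
  simp only [Algebra.algebraMap_self, RingHom.id_apply]
  congr 1
  rw [← blockExponent, Fintype.prod_sigma]
  refine Finset.prod_congr rfl fun i _ => ?_
  simp [blockExponent_apply, pow_ite]

theorem coeff_multilinearPoly (c : (∀ i, Fin (d i)) → K) (h : ∀ i, Fin (d i)) :
    coeff (blockExponent Finset.univ h) (multilinearPoly c) = c h := by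
  classical
  simp [multilinearPoly, coeff_sum, coeff_monomial, blockExponent_univ_injective.eq_iff]

theorem isWeightedHomogeneous_multilinearPoly (c : (∀ i, Fin (d i)) → K) (i : ι) :
    IsWeightedHomogeneous (blockWeight d i) (multilinearPoly c) 1 := by
  refine IsWeightedHomogeneous.sum _ _ _ fun h _ => isWeightedHomogeneous_monomial _ _ _ ?_
  simp [weight_blockWeight, blockExponent_apply]

/-- If `f` has degree one in the blocks in `I` and degree zero in the other ones, then only one
pair of monomials contributes to the coefficients of `f * g` at products of one variable from
each block. -/
theorem coeff_mul_of_blocks {f : MvPolynomial (Σ i, Fin (d i)) K} {I : Finset ι}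
    (hf : ∀ i, IsWeightedHomogeneous (blockWeight d i) f (if i ∈ I then 1 else 0))
    (g : MvPolynomial (Σ i, Fin (d i)) K) (h : ∀ i, Fin (d i)) :
    coeff (blockExponent Finset.univ h) (f * g) =
      coeff (blockExponent I h) f * coeff (blockExponent Iᶜ h) g := by
  classical
  have hsum : blockExponent I h + blockExponent Iᶜ h = blockExponent Finset.univ h :=
    Finset.sum_add_sum_compl I _
  rw [coeff_mul, Finset.sum_eq_single (blockExponent I h, blockExponent Iᶜ h)]
  · rintro ⟨s, t⟩ hst hne
    rw [Finset.HasAntidiagonal.mem_antidiagonal] at hst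
    by_contra hprod
    have hs : s = blockExponent I h := by
      ext ⟨i, j⟩
      have hdeg := hf i (left_ne_zero_of_mul hprod)
      rw [weight_blockWeight] at hdeg
      have hle (j) : s ⟨i, j⟩ ≤ if h i = j then 1 else 0 := by
        have := DFunLike.congr_fun hst ⟨i, j⟩
        simp only [Finsupp.add_apply, blockExponent_apply, Finset.mem_univ, true_and] at this
        omega
      have hzero (j) (hj : h i ≠ j) : s ⟨i, j⟩ = 0 := by simpa [hj] using hle j
      rw [Finset.sum_eq_single (h i) (fun j _ hj => hzero j hj.symm) (by simp)] at hdeg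
      rw [blockExponent_apply]
      by_cases hj : h i = j
      · subst hj
        simpa using hdeg
      · simp [hj, hzero j hj]
    subst hs
    rw [← hsum, add_right_inj] at hst
    exact hne (Prod.ext rfl hst)
  · intro H
    exact absurd (Finset.HasAntidiagonal.mem_antidiagonal.2 hsum) H

/-- A common divisor of polynomials of degree one in each block, not all zero, has degree one in
some of the blocks and degree zero in the other ones. -/
theorem exists_blocks_of_dvd {f : MvPolynomial (Σ i, Fin (d i)) K} {c : (∀ i, Fin (d i)) → K}
    (hc : multilinearPoly c ≠ 0) (hf : f ∣ multilinearPoly c) (hu : ¬ IsUnit f) :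
    ∃ I : Finset ι, I.Nonempty ∧
      ∀ i, IsWeightedHomogeneous (blockWeight d i) f (if i ∈ I then 1 else 0) := by
  obtain ⟨g, hg⟩ := hf
  have hfg : f * g ≠ 0 := hg ▸ hc
  choose a b hab ha _ using fun i =>
    IsWeightedHomogeneous.exists_of_mul (hg ▸ isWeightedHomogeneous_multilinearPoly c i) hfg
  have hI (i) : (if i ∈ Finset.univ.filter (fun i => a i = 1) then 1 else 0) = a i := by
    have := hab i
    simp only [Finset.mem_filter, Finset.mem_univ, true_and]
    split_ifs <;> omega
  refine ⟨Finset.univ.filter fun i => a i = 1, ?_, fun i => (hI i).symm ▸ ha i⟩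
  by_contra hemp
  rw [Finset.not_nonempty_iff_eq_empty] at hemp
  -- If `f` has degree zero in all blocks, it is a nonzero constant.
  have hconst : f = C (coeff 0 f) := by
    classical
    ext s
    rw [coeff_C]
    split_ifs with hs
    · rw [hs]
    · by_contra hne
      refine hs (Finsupp.ext ?_)
      rintro ⟨i, j⟩
      have := ha i hne
      rw [← hI i, hemp, weight_blockWeight] at this
      simp only [Finset.notMem_empty, if_false, Finset.sum_eq_zero_iff] at this
      exact (this j (Finset.mem_univ j)).symm
  refine hu (hconst ▸ (IsUnit.mk0 _ fun h0 => ?_).map C)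
  rw [h0, map_zero] at hconst
  exact left_ne_zero_of_mul hfg hconst

end Blocks

/-! ### The kernel locus and its codimension -/

section KernelLocus

variable {K : Type*} [Field K] {n : ℕ} {m : Fin (n + 1) → ℕ}

/-- The polynomial function `T(x₁, …, xₙ, e_k*)` on the product of the first `n` dual spaces. -/
noncomputable def slicePoly (T : PartTensor K m) (k : Fin (m (Fin.last n))) :
    MvPolynomial (Σ i : Fin n, Fin (m i.castSucc)) K :=
  multilinearPoly fun h => (stdBasis K m).repr T (Fin.snoc (α := fun i => Fin (m i)) h k)

theorem ofCoords_single {d : Fin n → ℕ} (c : (Σ i : Fin n, Fin (d i)) → K) (i : Fin n)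
    (j : Fin (d i)) : ofCoords c i (Pi.single j 1) = c ⟨i, j⟩ := by
  simp [ofCoords]

theorem mem_kernelLocus_iff (T : PartTensor K m) (c : (Σ i : Fin n, Fin (m i.castSucc)) → K) :
    ofCoords c ∈ T.kernelLocus ↔ ∀ k, aeval c (slicePoly T k) = 0 := by
  have key (y : Module.Dual K (Fin (m (Fin.last n)) → K)) :
      T.toMultilinear (Fin.snoc (α := fun i => Module.Dual K (Fin (m i) → K)) (ofCoords c) y) =
        ∑ k, aeval c (slicePoly T k) * y (Pi.single k 1) := by
    simp only [toMultilinear, LinearMap.compMultilinearMap_apply, LinearMap.comp_apply,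
      LinearMap.applyₗ_apply_apply]
    rw [dualDistrib_eq_sum, ← (Fin.snocEquiv fun i => Fin (m i)).sum_comp, Fintype.sum_prod_type]
    refine Finset.sum_congr rfl fun k _ => ?_
    rw [slicePoly, aeval_multilinearPoly, Finset.sum_mul]
    refine Finset.sum_congr rfl fun h _ => ?_
    simp [Fin.snocEquiv, Fin.prod_univ_castSucc, ofCoords_single, mul_assoc]
  constructor
  · intro H k
    have := H (LinearMap.proj k)
    rw [key] at this
    simpa [Pi.single_apply] using this
  · intro H y
    rw [key]
    simp [H]

theorem exists_slicePoly_ne_zero {T : PartTensor K m} (hT : T ≠ 0) : ∃ k, slicePoly T k ≠ 0 := by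
  obtain ⟨h, hh⟩ := exists_repr_ne_zero hT
  refine ⟨h (Fin.last n), fun H => hh ?_⟩
  have := coeff_multilinearPoly (fun h' => (stdBasis K m).repr T
    (Fin.snoc (α := fun i => Fin (m i)) h' (h (Fin.last n)))) (Fin.init h)
  rw [← slicePoly, H, coeff_zero, Fin.snoc_init_self] at this
  exact this.symm

theorem slicePoly_mem_vanishingIdeal (T : PartTensor K m) (k : Fin (m (Fin.last n))) :
    slicePoly T k ∈ vanishingIdeal K (ofCoords ⁻¹' T.kernelLocus) :=
  fun c hc => (mem_kernelLocus_iff T c).1 hc k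

theorem geometricRank_zero [Infinite K] : (0 : PartTensor K m).geometricRank = 0 := by
  rw [geometricRank, codim, Ideal.height_eq_zero_iff_eq_bot, eq_bot_iff]
  intro p hp
  refine MvPolynomial.funext fun c => ?_
  rw [map_zero, ← MvPolynomial.aeval_eq_eval]
  refine hp c ((mem_kernelLocus_iff 0 c).2 fun k => ?_)
  simp [slicePoly, aeval_multilinearPoly]

theorem one_le_geometricRank {T : PartTensor K m} (hT : T ≠ 0) : 1 ≤ T.geometricRank := by
  rw [Order.one_le_iff_ne_zero, geometricRank, codim, Ne, Ideal.height_eq_zero_iff_eq_bot]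
  intro H
  obtain ⟨k, hk⟩ := exists_slicePoly_ne_zero hT
  exact hk ((Submodule.mem_bot _).1 (H ▸ slicePoly_mem_vanishingIdeal T k))

/-- If `T`, as a multilinear function, has a factor `t` which involves at least one argument but
not the last one, then the kernel locus contains the hypersurface `t = 0`, so its codimension is
at most one by the Nullstellensatz and Krull's principal ideal theorem. -/
theorem geometricRank_le_one [IsAlgClosed K] (T : PartTensor K m) (p : Fin (n + 1) → Prop)
    [DecidablePred p] (hp : ∃ i, p i) (hlast : ¬ p (Fin.last n))
    (t : ⨂[K] i : {i // p i}, (Fin (m i) → K))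
    (r : (∀ i, Module.Dual K (Fin (m i) → K)) → K)
    (hT : ∀ x, T.toMultilinear x =
      PiTensorProduct.dualDistrib (PiTensorProduct.tprod K fun i : {i // p i} => x i) t * r x) :
    T.geometricRank ≤ 1 := by
  -- The value at `last n` is irrelevant, as `p` fails there.
  let L : ∀ i : Fin (n + 1), Fin (m i) → MvPolynomial (Σ i : Fin n, Fin (m i.castSucc)) K :=
    Fin.lastCases (fun _ => 0) fun i j => X ⟨i, j⟩
  let F := ∑ h, C ((stdBasis K fun i : {i // p i} => m i).repr t h) * ∏ i, L i.1 (h i)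
  have hL (c) (y : Module.Dual K (Fin (m (Fin.last n)) → K)) (i : Fin (n + 1)) (hi : p i)
      (j : Fin (m i)) : aeval c (L i j) =
        Fin.snoc (α := fun i => Module.Dual K (Fin (m i) → K)) (ofCoords c) y i
          (Pi.single j 1) := by
    induction i using Fin.lastCases with
    | last => exact absurd hi hlast
    | cast i => simp [L, ofCoords_single]
  have hF (c) (y : Module.Dual K (Fin (m (Fin.last n)) → K)) : aeval c F =
      PiTensorProduct.dualDistrib (PiTensorProduct.tprod K fun i : {i // p i} =>
        Fin.snoc (α := fun i => Module.Dual K (Fin (m i) → K)) (ofCoords c) y i) t := by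
    rw [dualDistrib_eq_sum, map_sum]
    refine Finset.sum_congr rfl fun h _ => ?_
    rw [map_mul, map_prod]
    congr 1
    · simp
    · exact Finset.prod_congr rfl fun i _ => hL c y i i.2 (h i)
  have hunit : ¬ IsUnit F := by
    intro H
    have h0 : aeval (0 : (Σ i : Fin n, Fin (m i.castSucc)) → K) F = 0 := by
      rw [hF 0 0, dualDistrib_eq_sum]
      obtain ⟨i, hi⟩ := hp
      refine Finset.sum_eq_zero fun h _ => ?_
      rw [Finset.prod_eq_zero (Finset.mem_univ ⟨i, hi⟩), mul_zero]
      induction i using Fin.lastCases with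
      | last => exact absurd hi hlast
      | cast i => simp [ofCoords_single]
    exact not_isUnit_zero (h0 ▸ H.map (aeval (0 : (Σ i : Fin n, Fin (m i.castSucc)) → K)))
  have hle : vanishingIdeal K (ofCoords ⁻¹' T.kernelLocus) ≤ (Ideal.span {F}).radical := by
    rw [← vanishingIdeal_zeroLocus_eq_radical (K := K)]
    refine vanishingIdeal_anti_mono fun c hc y => ?_
    rw [hT, ← hF, hc F (Ideal.mem_span_singleton_self F), zero_mul]
  obtain ⟨P, hP⟩ := Ideal.nonempty_minimalPrimes (I := Ideal.span {F})
    (by rwa [Ne, Ideal.span_singleton_eq_top])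
  have := hP.1.1
  rw [geometricRank, codim]
  exact (Ideal.height_mono (hle.trans (this.radical_le_iff.2 hP.1.2))).trans
    (Ideal.height_le_one_of_isPrincipal_of_mem_minimalPrimes _ P hP)

theorem HasPartitionRankOne.geometricRank_eq_one [IsAlgClosed K] {T : PartTensor K m}
    (h : T.HasPartitionRankOne) : T.geometricRank = 1 := by
  obtain ⟨I, ⟨i, hi⟩, ⟨j, hj⟩, T₁, T₂, h₁, h₂, rfl⟩ := h
  refine le_antisymm ?_ (one_le_geometricRank (outer_ne_zero I h₁ h₂))
  by_cases hlast : Fin.last n ∈ I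
  · refine geometricRank_le_one _ (· ∉ I) ⟨j, Finset.mem_compl.1 hj⟩ (not_not.2 hlast) T₂
      (fun x =>
        PiTensorProduct.dualDistrib (PiTensorProduct.tprod K fun i : {i // i ∈ I} => x i) T₁)
      fun x => ?_
    rw [toMultilinear_outer, mul_comm]
  · exact geometricRank_le_one _ (· ∈ I) ⟨i, hi⟩ hlast T₁ _ (toMultilinear_outer I T₁ T₂)

/-- A common factor `f` of the slices splits off from `T`: the coefficients of `f` form the first
tensor factor, those of the cofactors `g k`, with `k` as the last index, the second one. -/
theorem hasPartitionRankOne_of_dvd {T : PartTensor K m} (hT : T ≠ 0)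
    {f : MvPolynomial (Σ i : Fin n, Fin (m i.castSucc)) K} (hu : ¬ IsUnit f)
    (hf : ∀ k, f ∣ slicePoly T k) : T.HasPartitionRankOne := by
  obtain ⟨k₀, hk₀⟩ := exists_slicePoly_ne_zero hT
  obtain ⟨I, ⟨i₀, hi₀⟩, hI⟩ := exists_blocks_of_dvd hk₀ (hf k₀) hu
  choose g hg using hf
  have hcoeff (h : ∀ i, Fin (m i)) : (stdBasis K m).repr T h =
      coeff (blockExponent I (Fin.init h)) f *
        coeff (blockExponent Iᶜ (Fin.init h)) (g (h (Fin.last n))) := by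
    rw [← coeff_mul_of_blocks hI, ← hg, slicePoly, coeff_multilinearPoly, Fin.snoc_init_self]
  -- The index `e` serves to extend index tuples on `J` or its complement to all of `Fin (n + 1)`.
  obtain ⟨e, -⟩ := exists_repr_ne_zero hT
  let J : Finset (Fin (n + 1)) := I.map Fin.castSuccEmb
  have hJ (i : Fin n) : i.castSucc ∈ J ↔ i ∈ I := by simp [J]
  have hlast : Fin.last n ∉ J := by simp [J, Fin.castSucc_ne_last]
  let T₁ : ⨂[K] i : {i // i ∈ J}, (Fin (m i) → K) :=
    (stdBasis K fun i : {i // i ∈ J} => m i).equivFun.symm fun u =>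
      coeff (blockExponent I (Fin.init fun i => if h : i ∈ J then u ⟨i, h⟩ else e i)) f
  let T₂ : ⨂[K] i : {i // i ∉ J}, (Fin (m i) → K) :=
    (stdBasis K fun i : {i // i ∉ J} => m i).equivFun.symm fun u =>
      coeff (blockExponent Iᶜ (Fin.init fun i => if h : i ∉ J then u ⟨i, h⟩ else e i))
        (g (u ⟨Fin.last n, hlast⟩))
  have hT' : T = outer J T₁ T₂ := by
    refine (stdBasis K m).ext_elem fun h => ?_
    rw [repr_outer, hcoeff, ← Module.Basis.equivFun_apply, ← Module.Basis.equivFun_apply,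
      LinearEquiv.apply_symm_apply, LinearEquiv.apply_symm_apply]
    congr 2
    · refine blockExponent_congr fun i hi => ?_
      simp [Fin.init, (hJ i).2 hi]
    · refine blockExponent_congr fun i hi => ?_
      simp [Fin.init, (hJ i).not.2 (Finset.mem_compl.1 hi)]
  refine ⟨J, ⟨i₀.castSucc, (hJ i₀).2 hi₀⟩, ⟨Fin.last n, Finset.mem_compl.2 hlast⟩, T₁, T₂, ?_, ?_,
    hT'⟩
  · intro h0
    exact hT (by rw [hT', h0, ← outerBilinear_apply, map_zero, LinearMap.zero_apply])
  · intro h0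
    exact hT (by rw [hT', h0, ← outerBilinear_apply, map_zero])

theorem hasPartitionRankOne_of_geometricRank_eq_one [Infinite K] {T : PartTensor K m}
    (h : T.geometricRank = 1) : T.HasPartitionRankOne := by
  have hT : T ≠ 0 := by
    rintro rfl
    simp [geometricRank_zero] at h
  obtain ⟨P, hP, hle, hheight⟩ := Ideal.exists_isPrime_height_eq (n := 1) h
  obtain ⟨f, hf⟩ := (UniqueFactorizationMonoid.isPrincipal_of_height_eq_one hheight).principal
  refine hasPartitionRankOne_of_dvd hT (f := f) (fun hu => hP.ne_top ?_) fun k => ?_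
  · rw [hf]
    exact Ideal.span_singleton_eq_top.2 hu
  · have := hle (slicePoly_mem_vanishingIdeal T k)
    rw [hf] at this
    exact Ideal.mem_span_singleton.1 this

end KernelLocus

end PartTensor

theorem proposition6p3 {K : Type*} [Field K] [IsAlgClosed K] [CharZero K]
    (n : ℕ) (hn : 3 ≤ n + 1) (m : Fin (n + 1) → ℕ) (T : PartTensor K m) :
    T.geometricRank = 1 ↔ T.HasPartitionRankOne :=
  ⟨PartTensor.hasPartitionRankOne_of_geometricRank_eq_one,
    PartTensor.HasPartitionRankOne.geometricRank_eq_one⟩
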